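/- Let $\mathbb D=\{z\in\mathbb C:|z|<1\}$, let $dA$ denote area measure, and for real $\alpha$ and $0<p<\infty$ and an analytic function $f$ on $\mathbb D$ put $$M_{p,\alpha}(f,r)=\frac{\int_{|z|<r}|f(z)|^p(1-|z|^2)^\alpha\,dA(z)}{\int_{|z|<r}(1-|z|^2)^\alpha\,dA(z)},\qquad 0<r<1.$$ **Theorem 1.** Let $0<p<\infty$, let $-2\le\alpha\le 0$, and let $f$ be analytic in $\mathbb D$. Both integrals above are finite and the denominator is positive for every $r\in(0,1)$, and $M_{p,\alpha}(f,r)>0$ for every $r\in(0,1)$ unless $f$ vanishes identically. The function $r\mapsto M_{p,\alpha}(f,r)$ is logarithmically convex on $(0,1)$: $\log M_{p,\alpha}(f,r)$ is a convex function of $\log r$, that is, $t\mapsto\log M_{p,\alpha}(f,e^t)$ is convex on $(-\infty,0)$. (For $f\equiv0$ the mean is identically $0$ and the claim is trivial, whatever constant value $\log 0$ is given.) -/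

import Mathlib

open MeasureTheory Set

/-- The weight `(1 - |z|^2)^α` of the measure `dA_α(z) = (1 - |z|^2)^α dA(z)` on the unit disk. -/
noncomputable def areaWeight (α : ℝ) (z : ℂ) : ℝ := (1 - ‖z‖ ^ 2) ^ α

/-- The area integral mean `M_{p,α}(f,r)`: the average of `|f|^p` over the disk `|z| < r`
with respect to `dA_α`, where `dA` is area (Lebesgue) measure on the plane. -/
noncomputable def areaIntegralMean (p α : ℝ) (f : ℂ → ℂ) (r : ℝ) : ℝ :=
  (∫ z in Metric.ball (0 : ℂ) r, ‖f z‖ ^ p * areaWeight α z) /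
    (∫ z in Metric.ball (0 : ℂ) r, areaWeight α z)

/-- `log g(r)` is a convex function of `t = log r`, where `r` runs over `(0,1)`,
so that `t` runs over `(-∞,0)`. -/
def LogConvexInLog (g : ℝ → ℝ) : Prop :=
  ConvexOn ℝ (Iio (0 : ℝ)) (fun t => Real.log (g (Real.exp t)))

/-! Put s = log r and let W be `logWeight α`, K = (log W)', m(s) the integral of |f|^p over the
angle on the circle of radius e^s, and Φ and F the primitives of W and mW vanishing at -∞. Polar
coordinates turn the mean into F/(2πΦ), so the claim is that D = (log (F/Φ))' = v - u is
nondecreasing, where v = mW/F and u = W/Φ.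

By Hardy's theorem log m is convex; being bounded above at -∞, it is nondecreasing. With κ ≥ 0 the
right derivative of log m, the right derivative of D is v(κ + K - v) - u(K - u). The first product
is concave in v, so it only has to be bounded below at the ends of an interval containing v.
Monotonicity of m gives u ≤ v. The tangent line of log m at s gives v ≤ w, where w is the value v
would have if m were the power e^{κt}. The end u is immediate from κ ≥ 0; the end w is the case of a
power, `power_mean_deriv_nonneg`.

That case rests on `two_mul_le_deriv_slope_mul_sq`: K - 2(log Φ)' is nondecreasing, which comes down
to α(α + 2) ≤ 0. Hardy's theorem itself is proved for (|f|^2 + ε)^{p/2} by a Laplacian computation,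
and then ε tends to 0. -/

open Filter Topology

/-! ### Comparison of primitives vanishing at -∞ -/

/-- `F` is the primitive of `v` on `(-∞, 0)` that vanishes at `-∞`. -/
structure IsPrimitiveFromBot (F v : ℝ → ℝ) : Prop where
  hasDerivAt : ∀ s < 0, HasDerivAt F (v s) s
  tendsto : Tendsto F atBot (𝓝 0)

/-- The device behind the weight inequalities: a quantity that starts from 0 at -∞ and never
decreases is nonnegative, so only its derivative has to be examined. -/
theorem nonneg_of_hasDerivAt_nonneg_of_tendsto_atBot {G G' : ℝ → ℝ} {b : ℝ}
    (hG : ∀ s ≤ b, HasDerivAt G (G' s) s) (hG' : ∀ s ≤ b, 0 ≤ G' s)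
    (hlim : Tendsto G atBot (𝓝 0)) : 0 ≤ G b := by
  have hmono : MonotoneOn G (Iic b) := by
    refine monotoneOn_of_hasDerivWithinAt_nonneg (convex_Iic b)
      (fun s hs => (hG s hs).continuousAt.continuousWithinAt)
      (f' := G') (fun s hs => (hG s ?_).hasDerivWithinAt) (fun s hs => hG' s ?_)
    · exact mem_Iic.1 (interior_subset hs)
    · exact mem_Iic.1 (interior_subset hs)
  refine le_of_tendsto hlim ?_
  filter_upwards [eventually_le_atBot b] with s hs
  exact hmono hs (mem_Iic.2 le_rfl) hs

namespace IsPrimitiveFromBot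

theorem const_mul {F v : ℝ → ℝ} (h : IsPrimitiveFromBot F v) (k : ℝ) :
    IsPrimitiveFromBot (fun s => k * F s) (fun s => k * v s) :=
  ⟨fun s hs => (h.hasDerivAt s hs).const_mul k, by simpa using h.tendsto.const_mul k⟩

theorem le_of_le {F G v w : ℝ → ℝ} (hF : IsPrimitiveFromBot F v) (hG : IsPrimitiveFromBot G w)
    {b : ℝ} (hb : b < 0) (hvw : ∀ s ≤ b, v s ≤ w s) : F b ≤ G b := by
  have := nonneg_of_hasDerivAt_nonneg_of_tendsto_atBot (b := b)
    (fun s hs => (hG.hasDerivAt s (hs.trans_lt hb)).sub (hF.hasDerivAt s (hs.trans_lt hb)))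
    (fun s hs => sub_nonneg.2 (hvw s hs))
    (by rw [← sub_zero (0 : ℝ)]; exact hG.tendsto.sub hF.tendsto)
  simpa using this

theorem pos {F v : ℝ → ℝ} (hF : IsPrimitiveFromBot F v) (hv : ∀ s < 0, 0 < v s)
    {b : ℝ} (hb : b < 0) : 0 < F b := by
  have hmono : StrictMonoOn F (Iic b) := by
    refine strictMonoOn_of_hasDerivWithinAt_pos (convex_Iic b)
      (fun s hs => (hF.hasDerivAt s (lt_of_le_of_lt hs hb)).continuousAt.continuousWithinAt)
      (f' := v) (fun s hs => (hF.hasDerivAt s ?_).hasDerivWithinAt) (fun s hs => hv s ?_)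
    · exact lt_of_le_of_lt (interior_subset hs : s ∈ Iic b) hb
    · exact lt_of_le_of_lt (interior_subset hs : s ∈ Iic b) hb
  have h1 : 0 ≤ F (b - 1) := nonneg_of_hasDerivAt_nonneg_of_tendsto_atBot (b := b - 1)
    (fun s hs => hF.hasDerivAt s (by linarith)) (fun s hs => (hv s (by linarith)).le) hF.tendsto
  exact h1.trans_lt (hmono (by simp) (by simp) (by linarith))

end IsPrimitiveFromBot

/-! ### The weight in logarithmic coordinates and the case of a power -/

/-- The radial weight `ρ ^ 2 * (1 - ρ ^ 2) ^ α` at `ρ = exp s`. -/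
noncomputable def logWeight (α s : ℝ) : ℝ := Real.exp (2 * s) * (1 - Real.exp (2 * s)) ^ α

/-- The logarithmic derivative of `logWeight α`. -/
noncomputable def logWeightSlope (α s : ℝ) : ℝ :=
  2 - 2 * α * Real.exp (2 * s) / (1 - Real.exp (2 * s))

theorem one_sub_exp_two_mul_pos {s : ℝ} (hs : s < 0) : 0 < 1 - Real.exp (2 * s) := by
  have : Real.exp (2 * s) < 1 := Real.exp_lt_one_iff.2 (by linarith)
  linarith

theorem hasDerivAt_exp_two_mul (s : ℝ) :
    HasDerivAt (fun s => Real.exp (2 * s)) (2 * Real.exp (2 * s)) s := by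
  have := ((hasDerivAt_id s).const_mul 2).exp
  simpa [mul_comm] using this

theorem tendsto_exp_two_mul_atBot : Tendsto (fun s : ℝ => Real.exp (2 * s)) atBot (𝓝 0) :=
  Real.tendsto_exp_atBot.comp (tendsto_id.const_mul_atBot (by norm_num))

theorem logWeight_pos (α : ℝ) {s : ℝ} (hs : s < 0) : 0 < logWeight α s :=
  mul_pos (Real.exp_pos _) (Real.rpow_pos_of_pos (one_sub_exp_two_mul_pos hs) _)

theorem hasDerivAt_one_sub_exp_rpow (a : ℝ) {s : ℝ} (hs : s < 0) :
    HasDerivAt (fun s => (1 - Real.exp (2 * s)) ^ a)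
      (-2 * a * Real.exp (2 * s) * (1 - Real.exp (2 * s)) ^ a / (1 - Real.exp (2 * s))) s := by
  have hpos := one_sub_exp_two_mul_pos hs
  have h := ((hasDerivAt_exp_two_mul s).const_sub 1).rpow_const (p := a) (Or.inl hpos.ne')
  refine h.congr_deriv ?_
  rw [Real.rpow_sub_one hpos.ne']
  ring

theorem tendsto_one_sub_exp_rpow (a : ℝ) :
    Tendsto (fun s : ℝ => (1 - Real.exp (2 * s)) ^ a) atBot (𝓝 1) := by
  have h : Tendsto (fun s : ℝ => 1 - Real.exp (2 * s)) atBot (𝓝 1) := by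
    simpa using tendsto_exp_two_mul_atBot.const_sub 1
  simpa using h.rpow_const (p := a) (Or.inl one_ne_zero)

theorem hasDerivAt_logWeight (α : ℝ) {s : ℝ} (hs : s < 0) :
    HasDerivAt (logWeight α) (logWeightSlope α s * logWeight α s) s := by
  have hpos := one_sub_exp_two_mul_pos hs
  refine ((hasDerivAt_exp_two_mul s).mul (hasDerivAt_one_sub_exp_rpow α hs)).congr_deriv ?_
  simp only [logWeight, logWeightSlope]
  field_simp
  ring

theorem isPrimitiveFromBot_logWeight (α : ℝ) :
    IsPrimitiveFromBot (logWeight α) (fun s => logWeightSlope α s * logWeight α s) :=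
  ⟨fun _ hs => hasDerivAt_logWeight α hs, by
    rw [← zero_mul (1 : ℝ)]
    exact tendsto_exp_two_mul_atBot.mul (tendsto_one_sub_exp_rpow α)⟩

theorem hasDerivAt_logWeightSlope (α : ℝ) {s : ℝ} (hs : s < 0) :
    HasDerivAt (logWeightSlope α)
      (-4 * α * Real.exp (2 * s) / (1 - Real.exp (2 * s)) ^ 2) s := by
  have hpos := one_sub_exp_two_mul_pos hs
  have h := ((((hasDerivAt_exp_two_mul s).const_mul (2 * α)).div
    ((hasDerivAt_exp_two_mul s).const_sub 1) hpos.ne').const_sub 2)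
  refine h.congr_deriv ?_
  field_simp
  ring

theorem tendsto_logWeightSlope (α : ℝ) : Tendsto (logWeightSlope α) atBot (𝓝 2) := by
  have h := ((tendsto_exp_two_mul_atBot.const_mul (2 * α)).div
    (tendsto_exp_two_mul_atBot.const_sub 1) (by norm_num)).const_sub 2
  simp only [mul_zero, zero_div, sub_zero] at h
  exact h

theorem logWeightSlope_mono {α : ℝ} (hα : α ≤ 0) {s b : ℝ} (hsb : s ≤ b) (hb : b < 0) :
    logWeightSlope α s ≤ logWeightSlope α b := by
  have h1 : Real.exp (2 * s) ≤ Real.exp (2 * b) := Real.exp_le_exp.2 (by linarith)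
  have hpos := one_sub_exp_two_mul_pos hb
  have h2 : Real.exp (2 * s) / (1 - Real.exp (2 * s)) ≤
      Real.exp (2 * b) / (1 - Real.exp (2 * b)) :=
    div_le_div₀ (Real.exp_pos _).le h1 hpos (by linarith)
  simp only [logWeightSlope, mul_div_assoc]
  nlinarith

/-- W is the primitive of KW, and K(s) ≤ K(b) for s ≤ b because α ≤ 0. -/
theorem logWeight_le_slope_mul_primitive {α : ℝ} (hα : α ≤ 0) {Φ : ℝ → ℝ}
    (hΦ : IsPrimitiveFromBot Φ (logWeight α)) {b : ℝ} (hb : b < 0) :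
    logWeight α b ≤ logWeightSlope α b * Φ b :=
  (isPrimitiveFromBot_logWeight α).le_of_le (hΦ.const_mul (logWeightSlope α b)) hb fun _ hs =>
    mul_le_mul_of_nonneg_right (logWeightSlope_mono hα hs hb) (logWeight_pos α (hs.trans_lt hb)).le

/-- The function `K - 2 (log Φ)'`, where `K` is the logarithmic derivative of the weight,
is nondecreasing. -/
theorem two_mul_le_deriv_slope_mul_sq {α : ℝ} (hα₁ : -2 ≤ α) (hα₂ : α ≤ 0) {Φ : ℝ → ℝ}
    (hΦ : IsPrimitiveFromBot Φ (logWeight α)) {b : ℝ} (hb : b < 0) :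
    2 * logWeight α b * (logWeightSlope α b * Φ b - logWeight α b) ≤
      -4 * α * Real.exp (2 * b) / (1 - Real.exp (2 * b)) ^ 2 * Φ b ^ 2 := by
  -- This is the claim divided by W, since K'/W = -4α(1 - e^{2s})^{-α-2}. On differentiating, the
  -- terms in K'Φ and in KW cancel; only the derivative of (1 - e^{2s})^{-α-2} survives, and it
  -- carries the factor -α(α + 2).
  have key : 0 ≤ -4 * α * (1 - Real.exp (2 * b)) ^ (-α - 2) * Φ b ^ 2
      - 2 * (logWeightSlope α b * Φ b) + 2 * logWeight α b := by
    refine nonneg_of_hasDerivAt_nonneg_of_tendsto_atBot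
      (G := fun s => -4 * α * (1 - Real.exp (2 * s)) ^ (-α - 2) * Φ s ^ 2
        - 2 * (logWeightSlope α s * Φ s) + 2 * logWeight α s)
      (G' := fun s => 8 * (-α) * (α + 2) * Real.exp (2 * s) *
        ((1 - Real.exp (2 * s)) ^ (-α - 2) / (1 - Real.exp (2 * s))) * Φ s ^ 2) ?_ ?_ ?_
    · intro s hs
      have hs0 : s < 0 := hs.trans_lt hb
      have hpos := one_sub_exp_two_mul_pos hs0
      have h := (((((hasDerivAt_one_sub_exp_rpow (-α - 2) hs0).const_mul (-4 * α)).mul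
        ((hΦ.hasDerivAt s hs0).pow 2)).sub
        (((hasDerivAt_logWeightSlope α hs0).mul (hΦ.hasDerivAt s hs0)).const_mul 2)).add
        ((hasDerivAt_logWeight α hs0).const_mul 2))
      refine h.congr_deriv ?_
      have hr : (1 - Real.exp (2 * s)) ^ (-α - 2) =
          ((1 - Real.exp (2 * s)) ^ α)⁻¹ / (1 - Real.exp (2 * s)) ^ 2 := by
        rw [Real.rpow_sub hpos, Real.rpow_neg hpos.le, Real.rpow_two]
      have hrp := Real.rpow_pos_of_pos hpos α
      simp only [logWeight, hr, Pi.pow_apply]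
      field_simp
      ring
    · intro s hs
      have hpos := one_sub_exp_two_mul_pos (hs.trans_lt hb)
      have h1 : 0 ≤ -α := by linarith
      have h2 : 0 ≤ α + 2 := by linarith
      positivity
    · have h := ((((tendsto_one_sub_exp_rpow (-α - 2)).const_mul (-4 * α)).mul
        (hΦ.tendsto.pow 2)).sub
        (((tendsto_logWeightSlope α).mul hΦ.tendsto).const_mul 2)).add
        ((isPrimitiveFromBot_logWeight α).tendsto.const_mul 2)
      simpa using h
  have hpos := one_sub_exp_two_mul_pos hb
  have hrp := Real.rpow_pos_of_pos hpos α
  have hr : logWeight α b * (1 - Real.exp (2 * b)) ^ (-α - 2) =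
      Real.exp (2 * b) / (1 - Real.exp (2 * b)) ^ 2 := by
    rw [logWeight, Real.rpow_sub hpos, Real.rpow_neg hpos.le, Real.rpow_two]
    field_simp
  have := mul_nonneg (logWeight_pos α hb).le key
  have e : logWeight α b * (-4 * α * (1 - Real.exp (2 * b)) ^ (-α - 2) * Φ b ^ 2
      - 2 * (logWeightSlope α b * Φ b) + 2 * logWeight α b) =
      -4 * α * (logWeight α b * (1 - Real.exp (2 * b)) ^ (-α - 2)) * Φ b ^ 2
      - 2 * logWeight α b * (logWeightSlope α b * Φ b - logWeight α b) := by ring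
  rw [e, hr] at this
  have e2 : -4 * α * Real.exp (2 * b) / (1 - Real.exp (2 * b)) ^ 2 * Φ b ^ 2 =
    -4 * α * (Real.exp (2 * b) / (1 - Real.exp (2 * b)) ^ 2) * Φ b ^ 2 := by ring
  rw [e2]
  linarith

/-- The logarithmic convexity of the area means in the case of a power `ρ ^ c`. -/
theorem power_mean_deriv_nonneg {α : ℝ} (hα₁ : -2 ≤ α) (hα₂ : α ≤ 0) {Φ F : ℝ → ℝ} {c : ℝ}
    (hc : 0 ≤ c) (hΦ : IsPrimitiveFromBot Φ (logWeight α))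
    (hF : IsPrimitiveFromBot F (fun s => Real.exp (c * s) * logWeight α s)) {b : ℝ} (hb : b < 0) :
    0 ≤ (c + logWeightSlope α b) * F b - Real.exp (c * b) * logWeight α b -
      Real.exp (-(c * b)) * (logWeightSlope α b * Φ b - logWeight α b) * (F b / Φ b) ^ 2 := by
  have hΦpos : ∀ s < 0, 0 < Φ s := fun s hs => hΦ.pos (fun t ht => logWeight_pos α ht) hs
  have hFpos : ∀ s < 0, 0 < F s := fun s hs =>
    hF.pos (fun t ht => mul_pos (Real.exp_pos _) (logWeight_pos α ht)) hs
  have hFΦ : ∀ s < 0, F s ≤ Real.exp (c * s) * Φ s := fun s hs =>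
    hF.le_of_le (hΦ.const_mul _) hs fun t ht =>
      mul_le_mul_of_nonneg_right (Real.exp_le_exp.2 (mul_le_mul_of_nonneg_left ht hc))
        (logWeight_pos α (ht.trans_lt hs)).le
  -- The derivative is grouped into two nonnegative terms: F(1 - e^{-cs}F/Φ) times (K - 2W/Φ)', and
  -- a multiple of c(KΦ - W).
  refine nonneg_of_hasDerivAt_nonneg_of_tendsto_atBot
    (G := fun s => (c + logWeightSlope α s) * F s - Real.exp (c * s) * logWeight α s -
      Real.exp (-(c * s)) * (logWeightSlope α s * Φ s - logWeight α s) * (F s / Φ s) ^ 2)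
    (G' := fun s => F s * (1 - Real.exp (-(c * s)) * (F s / Φ s)) *
        (-4 * α * Real.exp (2 * s) / (1 - Real.exp (2 * s)) ^ 2 * Φ s ^ 2 -
          2 * logWeight α s * (logWeightSlope α s * Φ s - logWeight α s)) / Φ s ^ 2 +
        c * Real.exp (-(c * s)) * (logWeightSlope α s * Φ s - logWeight α s) * (F s / Φ s) ^ 2)
    ?_ ?_ ?_
  · intro s hs
    have hs0 : s < 0 := hs.trans_lt hb
    have hΦs := hΦpos s hs0
    have hexp : HasDerivAt (fun s => Real.exp (c * s)) (Real.exp (c * s) * c) s := by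
      simpa using ((hasDerivAt_id s).const_mul c).exp
    have hexpn : HasDerivAt (fun s => Real.exp (-(c * s))) (Real.exp (-(c * s)) * (-c)) s := by
      simpa using ((hasDerivAt_id s).const_mul c).neg.exp
    have hW := hasDerivAt_logWeight α hs0
    have hK := hasDerivAt_logWeightSlope α hs0
    have h1 := (hK.const_add c).mul (hF.hasDerivAt s hs0)
    have h2 := hexp.mul hW
    have h3 := ((hexpn.mul ((hK.mul (hΦ.hasDerivAt s hs0)).sub hW)).mul
      (((hF.hasDerivAt s hs0).div (hΦ.hasDerivAt s hs0) hΦs.ne').pow 2))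
    refine ((h1.sub h2).sub h3).congr_deriv ?_
    have hE : Real.exp (-(c * s)) = (Real.exp (c * s))⁻¹ := Real.exp_neg _
    have hEp := Real.exp_pos (c * s)
    simp only [Pi.mul_apply, Pi.sub_apply, Pi.div_apply, Pi.pow_apply, Nat.reduceSub, pow_one, hE]
    generalize -4 * α * Real.exp (2 * s) / (1 - Real.exp (2 * s)) ^ 2 = K'
    generalize Real.exp (c * s) = E at *
    field_simp
    ring
  · intro s hs
    have hs0 : s < 0 := hs.trans_lt hb
    have hΦs := hΦpos s hs0
    have hFs := hFpos s hs0
    have h1 := sub_nonneg.2 (two_mul_le_deriv_slope_mul_sq hα₁ hα₂ hΦ hs0)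
    have h2 := sub_nonneg.2 (logWeight_le_slope_mul_primitive hα₂ hΦ hs0)
    have h3 : 0 ≤ 1 - Real.exp (-(c * s)) * (F s / Φ s) := by
      rw [Real.exp_neg, sub_nonneg, ← div_eq_inv_mul, div_div, div_le_one (by positivity)]
      exact (hFΦ s hs0).trans_eq (mul_comm _ _)
    positivity
  · have hexp1 : ∀ s < 0, Real.exp (c * s) ≤ 1 := fun s hs =>
      Real.exp_le_one_iff.2 (mul_nonpos_of_nonneg_of_nonpos hc hs.le)
    have hW := (isPrimitiveFromBot_logWeight α).tendsto
    have hK := tendsto_logWeightSlope α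
    have hneg : ∀ᶠ s : ℝ in atBot, s < 0 := eventually_lt_atBot 0
    have t1 : Tendsto (fun s => (c + logWeightSlope α s) * F s) atBot (𝓝 0) := by
      simpa using (hK.const_add c).mul hF.tendsto
    have t2 : Tendsto (fun s => Real.exp (c * s) * logWeight α s) atBot (𝓝 0) := by
      refine tendsto_of_tendsto_of_tendsto_of_le_of_le' tendsto_const_nhds hW ?_ ?_
      · filter_upwards [hneg] with s hs
        exact mul_nonneg (Real.exp_pos _).le (logWeight_pos α hs).le
      · filter_upwards [hneg] with s hs
        exact mul_le_of_le_one_left (logWeight_pos α hs).le (hexp1 s hs)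
    -- The possible growth of e^{-cs} is absorbed by F/Φ ≤ e^{cs}, which gives e^{-cs}(F/Φ)^2 ≤
    -- e^{cs} ≤ 1.
    have t3 : Tendsto (fun s => Real.exp (-(c * s)) *
        (logWeightSlope α s * Φ s - logWeight α s) * (F s / Φ s) ^ 2) atBot (𝓝 0) := by
      have t4 : Tendsto (fun s => logWeightSlope α s * Φ s - logWeight α s) atBot (𝓝 0) := by
        simpa using (hK.mul hΦ.tendsto).sub hW
      refine tendsto_of_tendsto_of_tendsto_of_le_of_le' tendsto_const_nhds t4 ?_ ?_
      · filter_upwards [hneg] with s hs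
        have h2 := sub_nonneg.2 (logWeight_le_slope_mul_primitive hα₂ hΦ hs)
        positivity
      · filter_upwards [hneg] with s hs
        have h2 := sub_nonneg.2 (logWeight_le_slope_mul_primitive hα₂ hΦ hs)
        have hR : F s / Φ s ≤ Real.exp (c * s) := (div_le_iff₀ (hΦpos s hs)).2 (hFΦ s hs)
        have hR0 : 0 ≤ F s / Φ s := div_nonneg (hFpos s hs).le (hΦpos s hs).le
        have hR2 : Real.exp (-(c * s)) * (F s / Φ s) ^ 2 ≤ 1 := by
          calc Real.exp (-(c * s)) * (F s / Φ s) ^ 2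
              ≤ Real.exp (-(c * s)) * Real.exp (c * s) ^ 2 := by gcongr
            _ = Real.exp (c * s) := by rw [Real.exp_neg]; field_simp
            _ ≤ 1 := hexp1 s hs
        calc _ = (logWeightSlope α s * Φ s - logWeight α s) *
              (Real.exp (-(c * s)) * (F s / Φ s) ^ 2) := by ring
          _ ≤ _ := mul_le_of_le_one_right h2 hR2
    simpa using (t1.sub t2).sub t3

/-! ### From powers to general log-convex means -/

theorem mul_sub_ge_of_mem_Icc {A q u v w : ℝ} (huv : u ≤ v) (hvw : v ≤ w)
    (hu : q ≤ u * (A - u)) (hw : q ≤ w * (A - w)) : q ≤ v * (A - v) := by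
  rcases le_total 0 (A - u - v) with h | h
  · nlinarith [mul_nonneg (sub_nonneg.2 huv) h]
  · nlinarith [mul_nonneg (sub_nonneg.2 hvw) (show 0 ≤ v + w - A by linarith)]

/-- If `log m` is convex and nondecreasing, then the logarithm of the weighted average of `m` over
`(-∞, s)` with respect to `logWeight α` is a convex function of `s`. -/
theorem convexOn_log_primitive_div {α : ℝ} (hα₁ : -2 ≤ α) (hα₂ : α ≤ 0) {m Φ F : ℝ → ℝ}
    (hm : ∀ s < 0, 0 < m s) (hmono : MonotoneOn m (Iio 0))
    (hconv : ConvexOn ℝ (Iio 0) (fun s => Real.log (m s)))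
    (hΦ : IsPrimitiveFromBot Φ (logWeight α))
    (hF : IsPrimitiveFromBot F (fun s => m s * logWeight α s))
    (hpow : ∀ c, 0 ≤ c →
      ∃ P : ℝ → ℝ, IsPrimitiveFromBot P (fun s => Real.exp (c * s) * logWeight α s)) :
    ConvexOn ℝ (Iio 0) (fun s => Real.log (F s / Φ s)) := by
  have hW : ∀ s < 0, 0 < logWeight α s := fun s hs => logWeight_pos α hs
  have hΦpos : ∀ s < 0, 0 < Φ s := fun s hs => hΦ.pos hW hs
  have hFpos : ∀ s < 0, 0 < F s := fun s hs =>
    hF.pos (fun t ht => mul_pos (hm t ht) (hW t ht)) hs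
  have hint : interior (Iio (0 : ℝ)) = Iio 0 := interior_Iio
  -- Only convexity of log m is assumed, not differentiability; one-sided derivatives exist
  -- everywhere and suffice.
  set κ : ℝ → ℝ := fun s => derivWithin (fun s => Real.log (m s)) (Ioi s) s with hκ
  have hκd : ∀ s < 0, HasDerivWithinAt (fun s => Real.log (m s)) (κ s) (Ioi s) s := fun s hs =>
    hconv.hasDerivWithinAt_rightDeriv_of_mem_interior (by rwa [hint])
  have hslope : ∀ s < 0, ∀ t < s, slope (fun s => Real.log (m s)) t s ≤ κ s := fun s hs t ht =>
    (hconv.slope_le_leftDeriv_of_mem_interior (ht.trans hs) (by rwa [hint]) ht).trans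
      (hconv.leftDeriv_le_rightDeriv_of_mem_interior (by rwa [hint]))
  have hκ0 : ∀ s < 0, 0 ≤ κ s := fun s hs => by
    refine le_trans ?_ (hslope s hs (s - 1) (by linarith))
    have h1 : s - 1 < 0 := by linarith
    rw [slope_def_field]
    exact div_nonneg (sub_nonneg.2 (Real.log_le_log (hm _ h1)
      (hmono h1 hs (by linarith)))) (by linarith)
  have htangent : ∀ s < 0, ∀ t ≤ s, m s * Real.exp (-(κ s * s)) * Real.exp (κ s * t) ≤ m t := by
    intro s hs t ht
    rcases ht.eq_or_lt with rfl | ht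
    · rw [mul_assoc, ← Real.exp_add]; simp
    have h := hslope s hs t ht
    rw [slope_def_field, div_le_iff₀ (by linarith)] at h
    rw [← Real.log_le_log_iff (by have := hm s hs; positivity) (hm t (ht.trans hs)),
      Real.log_mul (by have := hm s hs; positivity) (Real.exp_pos _).ne',
      Real.log_mul (hm s hs).ne' (Real.exp_pos _).ne', Real.log_exp, Real.log_exp]
    linarith
  have hmd : ∀ s < 0, HasDerivWithinAt m (m s * κ s) (Ioi s) s := fun s hs => by
    have h := (hκd s hs).exp
    rw [Real.exp_log (hm s hs)] at h
    refine h.congr_of_eventuallyEq ?_ (Real.exp_log (hm s hs)).symm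
    filter_upwards [mem_nhdsWithin_of_mem_nhds (Iio_mem_nhds hs)] with t ht
    exact (Real.exp_log (hm t ht)).symm
  have hmc : ContinuousOn m (Iio 0) := by
    have h := hconv.continuousOn isOpen_Iio
    refine (h.rexp).congr fun s hs => (Real.exp_log (hm s hs)).symm
  set D : ℝ → ℝ := fun s => m s * logWeight α s / F s - logWeight α s / Φ s with hD
  have hDc : ContinuousOn D (Iio 0) := by
    have cF : ContinuousOn F (Iio 0) := fun s hs =>
      (hF.hasDerivAt s hs).continuousAt.continuousWithinAt
    have cΦ : ContinuousOn Φ (Iio 0) := fun s hs =>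
      (hΦ.hasDerivAt s hs).continuousAt.continuousWithinAt
    have cW : ContinuousOn (logWeight α) (Iio 0) := fun s hs =>
      (hasDerivAt_logWeight α hs).continuousAt.continuousWithinAt
    exact ((hmc.mul cW).div cF fun s hs => (hFpos s hs).ne').sub
      (cW.div cΦ fun s hs => (hΦpos s hs).ne')
  set D' : ℝ → ℝ := fun s =>
    m s * logWeight α s / F s * (κ s + logWeightSlope α s - m s * logWeight α s / F s) -
      logWeight α s / Φ s * (logWeightSlope α s - logWeight α s / Φ s) with hD'
  have hDd : ∀ s < 0, HasDerivWithinAt D (D' s) (Ici s) s := fun s hs => by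
    rw [hasDerivWithinAt_Ioi_iff_Ici.symm]
    have dF := (hF.hasDerivAt s hs).hasDerivWithinAt (s := Ioi s)
    have dΦ := (hΦ.hasDerivAt s hs).hasDerivWithinAt (s := Ioi s)
    have dW := (hasDerivAt_logWeight α hs).hasDerivWithinAt (s := Ioi s)
    refine ((((hmd s hs).mul dW).div dF (hFpos s hs).ne').sub
      (dW.div dΦ (hΦpos s hs).ne')).congr_deriv ?_
    have h1 := hFpos s hs
    have h2 := hΦpos s hs
    simp only [hD', Pi.mul_apply]
    field_simp
  have hDnn : ∀ s < 0, 0 ≤ D' s := fun s hs => by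
    obtain ⟨P, hP⟩ := hpow (κ s) (hκ0 s hs)
    have hPpos : 0 < P s := hP.pos (fun t ht => mul_pos (Real.exp_pos _) (hW t ht)) hs
    have h1 := hFpos s hs
    have h2 := hΦpos s hs
    have h3 := hm s hs
    have h4 := hW s hs
    have hFle : F s ≤ m s * Φ s := hF.le_of_le (hΦ.const_mul (m s)) hs fun t ht =>
      mul_le_mul_of_nonneg_right (hmono (ht.trans_lt hs) hs ht) (hW t (ht.trans_lt hs)).le
    have hleF : m s * Real.exp (-(κ s * s)) * P s ≤ F s :=
      (hP.const_mul _).le_of_le hF hs fun t ht => by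
        rw [← mul_assoc]
        exact mul_le_mul_of_nonneg_right (htangent s hs t ht) (hW t (ht.trans_lt hs)).le
    have hE := Real.exp_pos (κ s * s)
    rw [Real.exp_neg] at hleF
    have key := power_mean_deriv_nonneg hα₁ hα₂ (hκ0 s hs) hΦ hP hs
    rw [Real.exp_neg] at key
    rw [hD', sub_nonneg]
    -- Concavity of x(κ + K - x) reduces the bound at v = mW/F to the two ends: W/Φ, the value for
    -- constant m, and the value for the power e^{κt}. At the latter the difference is a positive
    -- multiple of the quantity in `key`.
    refine mul_sub_ge_of_mem_Icc (u := logWeight α s / Φ s)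
      (w := Real.exp (κ s * s) * logWeight α s / P s) ?_ ?_ ?_ ?_
    · rw [div_le_div_iff₀ h2 h1]
      nlinarith
    · rw [div_le_div_iff₀ h1 hPpos]
      have : m s * P s ≤ Real.exp (κ s * s) * F s := by
        have := mul_le_mul_of_nonneg_left hleF hE.le
        calc _ = Real.exp (κ s * s) * (m s * (Real.exp (κ s * s))⁻¹ * P s) := by field_simp
          _ ≤ _ := this
      nlinarith
    · refine mul_le_mul_of_nonneg_left ?_ (by positivity)
      linarith [hκ0 s hs]
    · have e : Real.exp (κ s * s) * logWeight α s / P s *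
          (κ s + logWeightSlope α s - Real.exp (κ s * s) * logWeight α s / P s) -
          logWeight α s / Φ s * (logWeightSlope α s - logWeight α s / Φ s) =
          Real.exp (κ s * s) * logWeight α s / P s ^ 2 *
          ((κ s + logWeightSlope α s) * P s - Real.exp (κ s * s) * logWeight α s -
          (Real.exp (κ s * s))⁻¹ * (logWeightSlope α s * Φ s - logWeight α s) *
            (P s / Φ s) ^ 2) := by
        field_simp
      rw [← sub_nonneg, e]
      exact mul_nonneg (by positivity) key
  have hDmono : MonotoneOn D (Iio 0) := by
    intro a ha b hb hab
    have hb' : b < 0 := hb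
    -- D has only a right derivative, so monotonicity comes from comparing D with the constant D a.
    have h := image_le_of_deriv_right_le_deriv_boundary (f := fun _ => D a) (f' := fun _ => 0)
      (a := a) (b := b) continuousOn_const (fun x _ => hasDerivWithinAt_const _ _ _)
      (B := D) (B' := D') le_rfl (hDc.mono fun x hx => lt_of_le_of_lt hx.2 hb')
      (fun x hx => hDd x (hx.2.trans hb')) (fun x hx => hDnn x (hx.2.trans hb'))
    exact h (right_mem_Icc.2 hab)
  have hlog : ∀ s < 0, HasDerivAt (fun s => Real.log (F s / Φ s)) (D s) s := fun s hs => by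
    have h1 := hFpos s hs
    have h2 := hΦpos s hs
    refine (((hF.hasDerivAt s hs).div (hΦ.hasDerivAt s hs) h2.ne').log
      (div_pos h1 h2).ne').congr_deriv ?_
    simp only [hD, Pi.div_apply]
    field_simp
  refine MonotoneOn.convexOn_of_deriv (convex_Iio 0)
    (fun s hs => (hlog s hs).continuousAt.continuousWithinAt)
    (fun s hs => (hlog s (by simpa using hs)).differentiableAt.differentiableWithinAt) ?_
  rw [hint]
  exact hDmono.congr fun s hs => (hlog s hs).deriv.symm

/-! ### Hardy's theorem for the regularized means -/

/-- The open left half-plane. -/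
abbrev leftHalfPlane : Set ℂ := {w | w.re < 0}

theorem isOpen_leftHalfPlane : IsOpen leftHalfPlane := isOpen_lt Complex.continuous_re continuous_const

theorem ofReal_add_mul_I_mem_leftHalfPlane {s : ℝ} (hs : s < 0) (θ : ℝ) :
    (s + θ * Complex.I : ℂ) ∈ leftHalfPlane := by simpa using hs

theorem continuous_vertical_slice {E : Type*} [TopologicalSpace E] {P : ℂ → E}
    (hP : ContinuousOn P leftHalfPlane) {s : ℝ} (hs : s < 0) :
    Continuous fun θ : ℝ => P (s + θ * Complex.I) :=
  hP.comp_continuous (by fun_prop) fun θ => ofReal_add_mul_I_mem_leftHalfPlane hs θ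

/-- Since 2s < s < s/2 < 0, a compact rectangle inside the half-plane surrounds the segment of
integration, and a bound for P' on it dominates the difference quotients. -/
theorem hasDerivAt_integral_vertical {P P' : ℂ → ℝ} (hP : ContinuousOn P leftHalfPlane)
    (hP' : ContinuousOn P' leftHalfPlane)
    (hd : ∀ s : ℝ, s < 0 → ∀ θ : ℝ, HasDerivAt (fun x : ℝ => P (x + θ * Complex.I))
      (P' (s + θ * Complex.I)) s) (a b : ℝ) {s : ℝ} (hs : s < 0) :
    HasDerivAt (fun x : ℝ => ∫ θ in a..b, P (x + θ * Complex.I))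
      (∫ θ in a..b, P' (s + θ * Complex.I)) s := by
  have hcomp : IsCompact (Icc (2 * s) (s / 2) ×ˢ uIcc a b) := isCompact_Icc.prod isCompact_uIcc
  obtain ⟨C, hC⟩ := hcomp.exists_bound_of_continuousOn
    (f := fun x : ℝ × ℝ => P' (x.1 + x.2 * Complex.I))
    (hP'.comp (by fun_prop) fun x hx =>
      ofReal_add_mul_I_mem_leftHalfPlane (lt_of_le_of_lt hx.1.2 (by linarith)) _)
  have hnhds : Ioo (2 * s) (s / 2) ∈ 𝓝 s := Ioo_mem_nhds (by linarith) (by linarith)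
  refine (intervalIntegral.hasDerivAt_integral_of_dominated_loc_of_deriv_le
    (F := fun (x : ℝ) (θ : ℝ) => P (x + θ * Complex.I))
    (F' := fun (x : ℝ) (θ : ℝ) => P' (x + θ * Complex.I)) (bound := fun _ => C)
    hnhds ?_ ?_ ?_ ?_ intervalIntegrable_const ?_).2
  · filter_upwards [hnhds] with x hx
    exact (continuous_vertical_slice hP (by linarith [hx.2])).aestronglyMeasurable
  · exact (continuous_vertical_slice hP hs).intervalIntegrable _ _
  · exact (continuous_vertical_slice hP' hs).aestronglyMeasurable
  · exact Eventually.of_forall fun θ hθ x hx =>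
      hC (x, θ) ⟨Ioo_subset_Icc_self hx, uIoc_subset_uIcc hθ⟩
  · exact Eventually.of_forall fun θ _ x hx => hd x (by linarith [hx.2]) θ

theorem hasDerivAt_sq_add_sq_rpow {u v : ℝ → ℝ} {u₁ v₁ x : ℝ} (hu : HasDerivAt u u₁ x)
    (hv : HasDerivAt v v₁ x) {ε : ℝ} (hε : 0 < ε) (q : ℝ) :
    HasDerivAt (fun x => (u x ^ 2 + v x ^ 2 + ε) ^ q)
      (2 * q * (u x ^ 2 + v x ^ 2 + ε) ^ (q - 1) * (u x * u₁ + v x * v₁)) x := by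
  have hpos : 0 < u x ^ 2 + v x ^ 2 + ε := by positivity
  refine ((((hu.pow 2).add (hv.pow 2)).add_const ε).rpow_const (p := q)
    (Or.inl hpos.ne')).congr_deriv ?_
  simp only [Pi.add_apply, Pi.pow_apply, Nat.reduceSub, pow_one]
  push_cast
  ring

/-- The functions u and v are arbitrary so that one formula serves both the horizontal and the
vertical second derivative. -/
theorem hasDerivAt_deriv_sq_add_sq_rpow {u v u₁ v₁ : ℝ → ℝ} {u₂ v₂ x : ℝ}
    (hu : HasDerivAt u (u₁ x) x) (hv : HasDerivAt v (v₁ x) x) (hu₁ : HasDerivAt u₁ u₂ x)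
    (hv₁ : HasDerivAt v₁ v₂ x) {ε : ℝ} (hε : 0 < ε) (q : ℝ) :
    HasDerivAt
      (fun x => 2 * q * (u x ^ 2 + v x ^ 2 + ε) ^ (q - 1) * (u x * u₁ x + v x * v₁ x))
      (2 * q * (u x ^ 2 + v x ^ 2 + ε) ^ (q - 2) *
        (2 * (q - 1) * (u x * u₁ x + v x * v₁ x) ^ 2 + (u x ^ 2 + v x ^ 2 + ε) *
          (u₁ x ^ 2 + v₁ x ^ 2 + u x * u₂ + v x * v₂))) x := by
  have hpos : 0 < u x ^ 2 + v x ^ 2 + ε := by positivity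
  refine (((hasDerivAt_sq_add_sq_rpow hu hv hε (q - 1)).const_mul (2 * q)).mul
    ((hu.mul hu₁).add (hv.mul hv₁))).congr_deriv ?_
  have e1 : (u x ^ 2 + v x ^ 2 + ε) ^ (q - 1) =
      (u x ^ 2 + v x ^ 2 + ε) ^ (q - 2) * (u x ^ 2 + v x ^ 2 + ε) := by
    rw [← Real.rpow_add_one hpos.ne']; congr 1; ring
  simp only [Pi.add_apply, Pi.mul_apply]
  rw [show q - 1 - 1 = q - 2 by ring, e1]
  ring

theorem hasDerivAt_horizontal {F : ℂ → ℂ} {F' : ℂ} {s θ : ℝ}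
    (h : HasDerivAt F F' (s + θ * Complex.I)) :
    HasDerivAt (fun x : ℝ => (F (x + θ * Complex.I)).re) F'.re s ∧
    HasDerivAt (fun x : ℝ => (F (x + θ * Complex.I)).im) F'.im s := by
  have h1 : HasDerivAt (fun x : ℝ => F (x + θ * Complex.I)) F' s := by
    have := h.scomp s ((Complex.ofRealCLM.hasDerivAt (x := s)).add_const (θ * Complex.I))
    exact this.congr_deriv (by simp)
  exact ⟨Complex.reCLM.hasFDerivAt.comp_hasDerivAt s h1,
    Complex.imCLM.hasFDerivAt.comp_hasDerivAt s h1⟩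

theorem hasDerivAt_vertical {F : ℂ → ℂ} {F' : ℂ} {s θ : ℝ}
    (h : HasDerivAt F F' (s + θ * Complex.I)) :
    HasDerivAt (fun y : ℝ => (F (s + y * Complex.I)).re) (-F'.im) θ ∧
    HasDerivAt (fun y : ℝ => (F (s + y * Complex.I)).im) F'.re θ := by
  have h1 : HasDerivAt (fun y : ℝ => F (s + y * Complex.I)) (Complex.I * F') θ := by
    have := h.scomp θ (((Complex.ofRealCLM.hasDerivAt (x := θ)).mul_const Complex.I).const_add
      (s : ℂ))
    exact this.congr_deriv (by simp)
  have h2 := Complex.reCLM.hasFDerivAt.comp_hasDerivAt θ h1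
  have h3 := Complex.imCLM.hasFDerivAt.comp_hasDerivAt θ h1
  exact ⟨h2.congr_deriv (by simp), h3.congr_deriv (by simp)⟩

theorem convexOn_log_of_second_deriv {m m₁ m₂ : ℝ → ℝ} (hpos : ∀ s < 0, 0 < m s)
    (h₁ : ∀ s < 0, HasDerivAt m (m₁ s) s) (h₂ : ∀ s < 0, HasDerivAt m₁ (m₂ s) s)
    (h : ∀ s < 0, m₁ s ^ 2 ≤ m s * m₂ s) :
    ConvexOn ℝ (Iio 0) (fun s => Real.log (m s)) := by
  have hd : ∀ s < 0, HasDerivAt (fun s => Real.log (m s)) (m₁ s / m s) s := fun s hs =>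
    (h₁ s hs).log (hpos s hs).ne'
  refine convexOn_of_hasDerivWithinAt2_nonneg (convex_Iio 0)
    (fun s hs => (hd s hs).continuousAt.continuousWithinAt)
    (f' := fun s => m₁ s / m s) (f'' := fun s => (m₂ s * m s - m₁ s * m₁ s) / m s ^ 2) ?_ ?_ ?_
  · intro s hs
    rw [interior_Iio] at hs
    exact (hd s hs).hasDerivWithinAt
  · intro s hs
    rw [interior_Iio] at hs
    exact ((h₂ s hs).div (h₁ s hs) (hpos s hs).ne').hasDerivWithinAt
  · intro s hs
    rw [interior_Iio] at hs
    have := h s hs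
    exact div_nonneg (by nlinarith) (sq_nonneg _)

/-- Hardy's convexity theorem for the regularization `(|F| ^ 2 + ε) ^ q`, in logarithmic
coordinates. -/
theorem convexOn_log_integral_regularized {F : ℂ → ℂ} (hF : DifferentiableOn ℂ F leftHalfPlane)
    (hper : ∀ w, F (w + 2 * Real.pi * Complex.I) = F w) {ε q : ℝ} (hε : 0 < ε) (hq : 0 < q) :
    ConvexOn ℝ (Iio 0) (fun s : ℝ => Real.log (∫ θ in (-Real.pi)..Real.pi,
      ((F (s + θ * Complex.I)).re ^ 2 + (F (s + θ * Complex.I)).im ^ 2 + ε) ^ q)) := by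
  set F₁ := deriv F with hF₁
  set F₂ := deriv F₁ with hF₂
  have hFa : AnalyticOnNhd ℂ F leftHalfPlane := hF.analyticOnNhd isOpen_leftHalfPlane
  have hF₁a : AnalyticOnNhd ℂ F₁ leftHalfPlane := hFa.deriv
  have hF₂a : AnalyticOnNhd ℂ F₂ leftHalfPlane := hF₁a.deriv
  have hd₀ : ∀ w ∈ leftHalfPlane, HasDerivAt F (F₁ w) w := fun w hw =>
    (hFa w hw).differentiableAt.hasDerivAt
  have hd₁ : ∀ w ∈ leftHalfPlane, HasDerivAt F₁ (F₂ w) w := fun w hw =>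
    (hF₁a w hw).differentiableAt.hasDerivAt
  have hper₁ : ∀ w, F₁ (w + 2 * Real.pi * Complex.I) = F₁ w := fun w => by
    rw [hF₁, ← deriv_comp_add_const]
    congr 1
    exact funext hper
  have cre : ContinuousOn (fun w => (F w).re) leftHalfPlane :=
    Complex.continuous_re.comp_continuousOn hFa.continuousOn
  have cim : ContinuousOn (fun w => (F w).im) leftHalfPlane :=
    Complex.continuous_im.comp_continuousOn hFa.continuousOn
  have cre₁ : ContinuousOn (fun w => (F₁ w).re) leftHalfPlane :=
    Complex.continuous_re.comp_continuousOn hF₁a.continuousOn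
  have cim₁ : ContinuousOn (fun w => (F₁ w).im) leftHalfPlane :=
    Complex.continuous_im.comp_continuousOn hF₁a.continuousOn
  have cre₂ : ContinuousOn (fun w => (F₂ w).re) leftHalfPlane :=
    Complex.continuous_re.comp_continuousOn hF₂a.continuousOn
  have cim₂ : ContinuousOn (fun w => (F₂ w).im) leftHalfPlane :=
    Complex.continuous_im.comp_continuousOn hF₂a.continuousOn
  have hApos : ∀ w, 0 < (F w).re ^ 2 + (F w).im ^ 2 + ε := fun w => by positivity
  have cA : ∀ a : ℝ, ContinuousOn (fun w => ((F w).re ^ 2 + (F w).im ^ 2 + ε) ^ a)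
      leftHalfPlane := fun a =>
    (((cre.pow 2).add (cim.pow 2)).add continuousOn_const).rpow_const
      fun w _ => Or.inl (hApos w).ne'
  set P : ℂ → ℝ := fun w => ((F w).re ^ 2 + (F w).im ^ 2 + ε) ^ q with hP
  set P₁ : ℂ → ℝ := fun w => 2 * q * ((F w).re ^ 2 + (F w).im ^ 2 + ε) ^ (q - 1) *
    ((F w).re * (F₁ w).re + (F w).im * (F₁ w).im) with hP₁
  set P₂ : ℂ → ℝ := fun w => 2 * q * ((F w).re ^ 2 + (F w).im ^ 2 + ε) ^ (q - 2) *
    (2 * (q - 1) * ((F w).re * (F₁ w).re + (F w).im * (F₁ w).im) ^ 2 +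
      ((F w).re ^ 2 + (F w).im ^ 2 + ε) *
      ((F₁ w).re ^ 2 + (F₁ w).im ^ 2 + (F w).re * (F₂ w).re + (F w).im * (F₂ w).im)) with hP₂
  -- Q₁ and Q₂ are the first two θ-derivatives of P, computed from ∂F/∂θ = iF'. Thus P₂ + Q₂ is the
  -- Laplacian of P, while Q₂ integrates to 0 over a period.
  set Q₁ : ℂ → ℝ := fun w => 2 * q * ((F w).re ^ 2 + (F w).im ^ 2 + ε) ^ (q - 1) *
    ((F w).re * (-(F₁ w).im) + (F w).im * (F₁ w).re) with hQ₁
  set Q₂ : ℂ → ℝ := fun w => 2 * q * ((F w).re ^ 2 + (F w).im ^ 2 + ε) ^ (q - 2) *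
    (2 * (q - 1) * ((F w).re * (-(F₁ w).im) + (F w).im * (F₁ w).re) ^ 2 +
      ((F w).re ^ 2 + (F w).im ^ 2 + ε) *
      ((-(F₁ w).im) ^ 2 + (F₁ w).re ^ 2 + (F w).re * (-(F₂ w).re) + (F w).im * (-(F₂ w).im)))
    with hQ₂
  have cP : ContinuousOn P leftHalfPlane := cA q
  have cP₁ : ContinuousOn P₁ leftHalfPlane := by
    have := cA (q - 1)
    fun_prop
  have cP₂ : ContinuousOn P₂ leftHalfPlane := by
    have := cA (q - 2)
    fun_prop
  have cQ₂ : ContinuousOn Q₂ leftHalfPlane := by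
    have := cA (q - 2)
    fun_prop
  have dP : ∀ s : ℝ, s < 0 → ∀ θ : ℝ, HasDerivAt (fun x : ℝ => P (x + θ * Complex.I))
      (P₁ (s + θ * Complex.I)) s := fun s hs θ => by
    obtain ⟨h1, h2⟩ := hasDerivAt_horizontal (hd₀ _ (ofReal_add_mul_I_mem_leftHalfPlane hs θ))
    exact hasDerivAt_sq_add_sq_rpow h1 h2 hε q
  have dP₁ : ∀ s : ℝ, s < 0 → ∀ θ : ℝ, HasDerivAt (fun x : ℝ => P₁ (x + θ * Complex.I))
      (P₂ (s + θ * Complex.I)) s := fun s hs θ => by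
    obtain ⟨h1, h2⟩ := hasDerivAt_horizontal (hd₀ _ (ofReal_add_mul_I_mem_leftHalfPlane hs θ))
    obtain ⟨h3, h4⟩ := hasDerivAt_horizontal (hd₁ _ (ofReal_add_mul_I_mem_leftHalfPlane hs θ))
    exact hasDerivAt_deriv_sq_add_sq_rpow
      (u₁ := fun x : ℝ => (F₁ (x + θ * Complex.I)).re)
      (v₁ := fun x : ℝ => (F₁ (x + θ * Complex.I)).im) h1 h2 h3 h4 hε q
  have dQ₁ : ∀ s : ℝ, s < 0 → ∀ θ : ℝ, HasDerivAt (fun y : ℝ => Q₁ (s + y * Complex.I))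
      (Q₂ (s + θ * Complex.I)) θ := fun s hs θ => by
    obtain ⟨h1, h2⟩ := hasDerivAt_vertical (hd₀ _ (ofReal_add_mul_I_mem_leftHalfPlane hs θ))
    obtain ⟨h3, h4⟩ := hasDerivAt_vertical (hd₁ _ (ofReal_add_mul_I_mem_leftHalfPlane hs θ))
    exact hasDerivAt_deriv_sq_add_sq_rpow
      (u₁ := fun y : ℝ => -(F₁ (s + y * Complex.I)).im)
      (v₁ := fun y : ℝ => (F₁ (s + y * Complex.I)).re) h1 h2 h4.neg h3 hε q
  have hpi : -Real.pi < Real.pi := by linarith [Real.pi_pos]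
  have hint : ∀ {R : ℂ → ℝ}, ContinuousOn R leftHalfPlane → ∀ s : ℝ, s < 0 →
      IntervalIntegrable (fun θ : ℝ => R (s + θ * Complex.I)) volume (-Real.pi) Real.pi :=
    fun hR s hs => (continuous_vertical_slice hR hs).intervalIntegrable _ _
  have hQ0 : ∀ s : ℝ, s < 0 → ∫ θ in (-Real.pi)..Real.pi, Q₂ (s + θ * Complex.I) = 0 := by
    intro s hs
    rw [intervalIntegral.integral_eq_sub_of_hasDerivAt (fun θ _ => dQ₁ s hs θ) (hint cQ₂ s hs)]
    have e : (s + Real.pi * Complex.I : ℂ) =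
        (s + ((-Real.pi : ℝ) : ℂ) * Complex.I) + 2 * Real.pi * Complex.I := by
      push_cast; ring
    simp only [hQ₁]
    rw [e, hper, hper₁, sub_self]
  have hmpos : ∀ s : ℝ, s < 0 → 0 < ∫ θ in (-Real.pi)..Real.pi, P (s + θ * Complex.I) :=
    fun s hs => intervalIntegral.intervalIntegral_pos_of_pos (hint cP s hs)
      (fun θ => Real.rpow_pos_of_pos (hApos _) _) hpi
  refine convexOn_log_of_second_deriv hmpos
    (fun s hs => hasDerivAt_integral_vertical cP cP₁ dP _ _ hs)
    (fun s hs => hasDerivAt_integral_vertical cP₁ cP₂ dP₁ _ _ hs) fun s hs => ?_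
  set M := ∫ θ in (-Real.pi)..Real.pi, P (s + θ * Complex.I) with hM
  set M₁ := ∫ θ in (-Real.pi)..Real.pi, P₁ (s + θ * Complex.I) with hM₁
  have hMpos : 0 < M := hmpos s hs
  -- The inequality holds with any real l in place of M₁/M. Integrated, it bounds the second
  -- derivative of the mean below by 2lM₁ - l²M, which is largest at l = M₁/M, with value M₁²/M.
  have hpt : ∀ w, 2 * (M₁ / M) * P₁ w - (M₁ / M) ^ 2 * P w ≤ P₂ w + Q₂ w := by
    intro w
    generalize M₁ / M = l
    have hA := hApos w
    have hB := Real.rpow_pos_of_pos hA (q - 2)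
    have e1 : ((F w).re ^ 2 + (F w).im ^ 2 + ε) ^ (q - 1) =
        ((F w).re ^ 2 + (F w).im ^ 2 + ε) ^ (q - 2) * ((F w).re ^ 2 + (F w).im ^ 2 + ε) := by
      rw [← Real.rpow_add_one hA.ne']; congr 1; ring
    have e0 : ((F w).re ^ 2 + (F w).im ^ 2 + ε) ^ q =
        ((F w).re ^ 2 + (F w).im ^ 2 + ε) ^ (q - 2) *
          ((F w).re ^ 2 + (F w).im ^ 2 + ε) ^ 2 := by
      calc _ = ((F w).re ^ 2 + (F w).im ^ 2 + ε) ^ (q - 1) *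
            ((F w).re ^ 2 + (F w).im ^ 2 + ε) := by
              rw [← Real.rpow_add_one hA.ne']; congr 1; ring
        _ = _ := by rw [e1]; ring
    simp only [hP, hP₁, hP₂, hQ₂]
    rw [e1, e0, ← sub_nonneg]
    generalize ((F w).re ^ 2 + (F w).im ^ 2 + ε) ^ (q - 2) = B at *
    generalize (F w).re = a at *
    generalize (F w).im = b at *
    generalize (F₁ w).re = a₁
    generalize (F₁ w).im = b₁
    -- The F'' terms of P₂ and Q₂ cancel. Here a a₁ + b b₁ and a b₁ - b a₁ are the real and
    -- imaginary parts of conj(F) F', and their squares add up to |F|²|F'|².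
    have : 0 ≤ B * ((2 * q * (a * a₁ + b * b₁) - l * (a ^ 2 + b ^ 2 + ε)) ^ 2 +
        4 * q ^ 2 * (a * b₁ - b * a₁) ^ 2 + 4 * q * ε * (a₁ ^ 2 + b₁ ^ 2)) := by positivity
    refine this.trans_eq ?_
    ring
  have hle := intervalIntegral.integral_mono hpi.le
    (((hint cP₁ s hs).const_mul (2 * (M₁ / M))).sub ((hint cP s hs).const_mul ((M₁ / M) ^ 2)))
    ((hint cP₂ s hs).add (hint cQ₂ s hs)) (fun θ => hpt (s + θ * Complex.I))
  rw [intervalIntegral.integral_sub ((hint cP₁ s hs).const_mul _) ((hint cP s hs).const_mul _),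
    intervalIntegral.integral_const_mul, intervalIntegral.integral_const_mul,
    intervalIntegral.integral_add (hint cP₂ s hs) (hint cQ₂ s hs), hQ0 s hs, add_zero,
    ← hM, ← hM₁] at hle
  have e : 2 * (M₁ / M) * M₁ - (M₁ / M) ^ 2 * M = M₁ ^ 2 / M := by field_simp; ring
  rw [e, div_le_iff₀ hMpos] at hle
  linarith

/-! ### Circular means of |f|^p: positivity, convexity, monotonicity -/

/-- The integral of `|f| ^ p` over the circle of radius `ρ` with respect to the angle. -/
noncomputable def circlePowerIntegral (p : ℝ) (f : ℂ → ℂ) (ρ : ℝ) : ℝ :=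
  ∫ θ in (-Real.pi)..Real.pi, ‖f (ρ * Complex.exp (θ * Complex.I))‖ ^ p

theorem norm_mul_exp_mul_I {ρ : ℝ} (hρ : 0 ≤ ρ) (θ : ℝ) :
    ‖(ρ * Complex.exp (θ * Complex.I) : ℂ)‖ = ρ := by
  rw [norm_mul, Complex.norm_exp_ofReal_mul_I, Complex.norm_real, Real.norm_of_nonneg hρ, mul_one]

theorem mul_exp_mul_I_mem_ball {ρ : ℝ} (hρ : ρ ∈ Ico (0 : ℝ) 1) (θ : ℝ) :
    (ρ * Complex.exp (θ * Complex.I) : ℂ) ∈ Metric.ball (0 : ℂ) 1 := by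
  rw [mem_ball_zero_iff, norm_mul_exp_mul_I hρ.1]
  exact hρ.2

theorem continuousOn_circlePowerIntegral {p : ℝ} (hp : 0 < p) {f : ℂ → ℂ}
    (hf : ContinuousOn f (Metric.ball (0 : ℂ) 1)) :
    ContinuousOn (circlePowerIntegral p f) (Ico 0 1) := by
  rw [continuousOn_iff_continuous_domRestrict]
  refine intervalIntegral.continuous_parametric_intervalIntegral_of_continuous'
    (f := fun (ρ : Ico (0 : ℝ) 1) (θ : ℝ) =>
      ‖f ((ρ : ℝ) * Complex.exp (θ * Complex.I))‖ ^ p) ?_ _ _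
  refine Continuous.rpow_const ?_ fun _ => Or.inr hp.le
  have hc : Continuous fun x : Ico (0 : ℝ) 1 × ℝ =>
      ((x.1 : ℝ) * Complex.exp (x.2 * Complex.I) : ℂ) := by fun_prop
  have h : Continuous fun x : Ico (0 : ℝ) 1 × ℝ =>
      f ((x.1 : ℝ) * Complex.exp (x.2 * Complex.I)) :=
    hf.comp_continuous hc fun x => mul_exp_mul_I_mem_ball x.1.2 x.2
  exact h.norm

/-- If f vanished on the whole circle, its zeros would accumulate at the point ρ, and the identity
theorem would make f vanish on the disk. -/
theorem circlePowerIntegral_pos {p : ℝ} (hp : 0 < p) {f : ℂ → ℂ}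
    (hf : AnalyticOnNhd ℂ f (Metric.ball (0 : ℂ) 1)) (hne : ∃ z ∈ Metric.ball (0 : ℂ) 1, f z ≠ 0)
    {ρ : ℝ} (hρ : ρ ∈ Ioo (0 : ℝ) 1) : 0 < circlePowerIntegral p f ρ := by
  have hρ' : ρ ∈ Ico (0 : ℝ) 1 := ⟨hρ.1.le, hρ.2⟩
  have hcont : Continuous fun θ : ℝ => ‖f (ρ * Complex.exp (θ * Complex.I))‖ ^ p :=
    Continuous.rpow_const (hf.continuousOn.comp_continuous (by fun_prop)
      fun θ => mul_exp_mul_I_mem_ball hρ' θ).norm fun _ => Or.inr hp.le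
  have hpi : -Real.pi < Real.pi := by linarith [Real.pi_pos]
  obtain ⟨θ, hθ, hfθ⟩ : ∃ θ ∈ Icc (-Real.pi) Real.pi, f (ρ * Complex.exp (θ * Complex.I)) ≠ 0 := by
    by_contra! hzero
    obtain ⟨z, hz, hfz⟩ := hne
    refine hfz (hf.eqOn_zero_of_preconnected_of_frequently_eq_zero
      (convex_ball _ _).isPreconnected (mul_exp_mul_I_mem_ball hρ' 0) ?_ hz)
    have ht : Tendsto (fun θ : ℝ => (ρ * Complex.exp (θ * Complex.I) : ℂ)) (𝓝[>] 0)
        (𝓝[≠] (ρ * Complex.exp ((0 : ℝ) * Complex.I))) := by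
      refine tendsto_nhdsWithin_iff.2 ⟨?_, ?_⟩
      · have : Continuous fun θ : ℝ => (ρ * Complex.exp (θ * Complex.I) : ℂ) := by fun_prop
        exact this.continuousAt.tendsto.mono_left nhdsWithin_le_nhds
      · filter_upwards [Ioo_mem_nhdsGT Real.pi_pos] with θ hθ h
        have h1 := (congrArg Complex.arg h)
        rw [Complex.arg_real_mul _ hρ.1, Complex.arg_real_mul _ hρ.1,
          Complex.arg_exp_mul_I, Complex.arg_exp_mul_I,
          (toIocMod_eq_self _).2 ⟨by linarith [hθ.1], by linarith [hθ.2]⟩,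
          (toIocMod_eq_self _).2 ⟨by linarith, by linarith [Real.pi_pos]⟩] at h1
        exact hθ.1.ne' h1
    refine ht.frequently (Eventually.frequently ?_)
    filter_upwards [Ioo_mem_nhdsGT Real.pi_pos] with θ hθ
    exact hzero θ ⟨by linarith [hθ.1, Real.pi_pos], hθ.2.le⟩
  exact intervalIntegral.integral_pos hpi hcont.continuousOn
    (fun _ _ => Real.rpow_nonneg (norm_nonneg _) _)
    ⟨θ, hθ, Real.rpow_pos_of_pos (norm_pos_iff.2 hfθ) _⟩

theorem exp_mem_Ioo {s : ℝ} (hs : s < 0) : Real.exp s ∈ Ioo (0 : ℝ) 1 :=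
  ⟨Real.exp_pos s, Real.exp_lt_one_iff.2 hs⟩

/-- **Hardy's convexity theorem**: the logarithm of the circular means of `|f| ^ p` is a convex
function of the logarithm of the radius. -/
theorem convexOn_log_circlePowerIntegral {p : ℝ} (hp : 0 < p) {f : ℂ → ℂ}
    (hf : AnalyticOnNhd ℂ f (Metric.ball (0 : ℂ) 1))
    (hne : ∃ z ∈ Metric.ball (0 : ℂ) 1, f z ≠ 0) :
    ConvexOn ℝ (Iio 0) (fun s => Real.log (circlePowerIntegral p f (Real.exp s))) := by
  set F : ℂ → ℂ := fun w => f (Complex.exp w) with hF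
  have hmaps : MapsTo Complex.exp leftHalfPlane (Metric.ball (0 : ℂ) 1) := fun w hw => by
    rw [mem_ball_zero_iff, Complex.norm_exp]
    exact (exp_mem_Ioo hw).2
  have hFd : DifferentiableOn ℂ F leftHalfPlane :=
    hf.differentiableOn.comp Complex.differentiable_exp.differentiableOn hmaps
  have hper : ∀ w, F (w + 2 * Real.pi * Complex.I) = F w := fun w => by
    simp only [hF, Complex.exp_periodic w]
  have hq : 0 < p / 2 := by positivity
  set m : ℝ → ℝ → ℝ := fun ε s => ∫ θ in (-Real.pi)..Real.pi,
      ((F (s + θ * Complex.I)).re ^ 2 + (F (s + θ * Complex.I)).im ^ 2 + ε) ^ (p / 2) with hm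
  have hm0 : ∀ s, m 0 s = circlePowerIntegral p f (Real.exp s) := fun s => by
    refine intervalIntegral.integral_congr fun θ _ => ?_
    have e : (Real.exp s * Complex.exp (θ * Complex.I) : ℂ) =
        Complex.exp (s + θ * Complex.I) := by
      rw [Complex.exp_add, Complex.ofReal_exp]
    simp only [add_zero, hF, e]
    rw [← Complex.sq_norm_sub_sq_re]
    rw [add_sub_cancel, ← Real.rpow_two, ← Real.rpow_mul (norm_nonneg _)]
    congr 1
    ring
  have hlim : ∀ s < 0, Tendsto (fun ε => Real.log (m ε s)) (𝓝[>] 0)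
      (𝓝 (Real.log (circlePowerIntegral p f (Real.exp s)))) := fun s hs => by
    rw [← hm0]
    have hFs := continuous_vertical_slice hFd.continuousOn hs
    have hc : Continuous fun ε => m ε s := by
      refine intervalIntegral.continuous_parametric_intervalIntegral_of_continuous'
        (f := fun (ε : ℝ) (θ : ℝ) =>
        ((F (s + θ * Complex.I)).re ^ 2 + (F (s + θ * Complex.I)).im ^ 2 + ε) ^ (p / 2)) ?_ _ _
      refine Continuous.rpow_const ?_ fun _ => Or.inr hq.le
      have h1 : Continuous fun x : ℝ × ℝ => F (s + x.2 * Complex.I) :=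
        hFs.comp continuous_snd
      exact (((Complex.continuous_re.comp h1).pow 2).add
        ((Complex.continuous_im.comp h1).pow 2)).add continuous_fst
    refine Tendsto.log (hc.continuousAt.tendsto.mono_left nhdsWithin_le_nhds) ?_
    rw [hm0]
    -- A nonzero limit is what allows the logarithm to pass to the limit ε → 0.
    exact (circlePowerIntegral_pos hp hf hne (exp_mem_Ioo hs)).ne'
  refine ⟨convex_Iio 0, fun x hx y hy a b ha hb hab => ?_⟩
  refine le_of_tendsto_of_tendsto (hlim _ ((convex_Iio 0) hx hy ha hb hab))
    (((hlim x hx).const_smul a).add ((hlim y hy).const_smul b)) ?_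
  filter_upwards [self_mem_nhdsWithin] with ε hε
  exact (convexOn_log_integral_regularized hFd hper hε hq).2 hx hy ha hb hab

/-- A drop from s to t would, by convexity, force slopes at most -δ < 0 to the left of s, hence
growth to +∞ at -∞. -/
theorem ConvexOn.monotoneOn_Iio_of_eventually_le {g : ℝ → ℝ} {b C : ℝ}
    (hg : ConvexOn ℝ (Iio b) g) (hC : ∀ᶠ s in atBot, g s ≤ C) : MonotoneOn g (Iio b) := by
  intro s hs t ht hst
  by_contra! hlt
  have hst' : s < t := lt_of_le_of_ne hst (by rintro rfl; exact lt_irrefl _ hlt)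
  set δ := (g s - g t) / (t - s) with hδ
  have hδpos : 0 < δ := div_pos (by linarith) (by linarith)
  have hle : ∀ᶠ r in atBot, g s + δ * (s - r) ≤ C := by
    filter_upwards [hC, eventually_lt_atBot s] with r hr hrs
    have h := hg.slope_mono_adjacent (hrs.trans hs) ht hrs hst'
    have e : (g t - g s) / (t - s) = -δ := by rw [hδ, ← neg_div, neg_sub]
    rw [e, div_le_iff₀ (by linarith)] at h
    linarith
  have htop : Tendsto (fun r : ℝ => g s + δ * (s - r)) atBot atTop := by
    refine tendsto_atTop_add_const_left _ _ (Tendsto.const_mul_atTop hδpos ?_)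
    exact tendsto_atTop_add_const_left _ _ tendsto_neg_atBot_atTop
  obtain ⟨r, h1, h2⟩ := (hle.and (htop.eventually_gt_atTop C)).exists
  linarith

theorem monotoneOn_circlePowerIntegral_exp {p : ℝ} (hp : 0 < p) {f : ℂ → ℂ}
    (hf : AnalyticOnNhd ℂ f (Metric.ball (0 : ℂ) 1))
    (hne : ∃ z ∈ Metric.ball (0 : ℂ) 1, f z ≠ 0) :
    MonotoneOn (fun s => circlePowerIntegral p f (Real.exp s)) (Iio 0) := by
  have hpos : ∀ s < 0, 0 < circlePowerIntegral p f (Real.exp s) := fun s hs =>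
    circlePowerIntegral_pos hp hf hne (exp_mem_Ioo hs)
  have hlim : Tendsto (fun s => circlePowerIntegral p f (Real.exp s)) atBot
      (𝓝 (circlePowerIntegral p f 0)) := by
    refine Tendsto.comp (continuousOn_circlePowerIntegral hp hf.continuousOn 0 (by simp))
      (tendsto_nhdsWithin_iff.2 ⟨Real.tendsto_exp_atBot, ?_⟩)
    filter_upwards [eventually_lt_atBot 0] with s hs
    exact ⟨(exp_mem_Ioo hs).1.le, (exp_mem_Ioo hs).2⟩
  -- Adding 1 gives a strict upper bound near -∞ with a positive argument of the logarithm, even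
  -- when f(0) = 0.
  have hmono := (convexOn_log_circlePowerIntegral hp hf hne).monotoneOn_Iio_of_eventually_le
    (C := Real.log (circlePowerIntegral p f 0 + 1)) (by
      filter_upwards [hlim.eventually_lt_const (lt_add_one _), eventually_lt_atBot 0] with s h1 h2
      exact Real.log_le_log (hpos s h2) h1.le)
  intro s hs t ht hst
  exact (Real.log_le_log_iff (hpos s hs) (hpos t ht)).1 (hmono hs ht hst)

/-! ### Area integrals in polar coordinates -/

theorem continuousOn_radialWeight (α : ℝ) :
    ContinuousOn (fun ρ : ℝ => ρ * (1 - ρ ^ 2) ^ α) (Ico 0 1) := by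
  refine continuousOn_id.mul (ContinuousOn.rpow_const (by fun_prop) fun ρ hρ => Or.inl ?_)
  have := hρ.1
  have := hρ.2
  nlinarith

/-- The substitution ρ = e^s contributes a second factor e^s, which turns ρ(1 - ρ²)^α dρ into W ds.
-/
theorem isPrimitiveFromBot_radialIntegral (α : ℝ) {h : ℝ → ℝ} (hh : ContinuousOn h (Ico 0 1)) :
    IsPrimitiveFromBot (fun s => ∫ ρ in (0 : ℝ)..Real.exp s, h ρ * (ρ * (1 - ρ ^ 2) ^ α))
      (fun s => h (Real.exp s) * logWeight α s) := by
  have hk : ContinuousOn (fun ρ : ℝ => h ρ * (ρ * (1 - ρ ^ 2) ^ α)) (Ico 0 1) :=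
    hh.mul (continuousOn_radialWeight α)
  have hint : ∀ b ∈ Ioo (0 : ℝ) 1, ContinuousOn (fun ρ : ℝ => h ρ * (ρ * (1 - ρ ^ 2) ^ α))
      (uIcc 0 b) := fun b hb => by
    rw [uIcc_of_le hb.1.le]
    exact hk.mono fun x hx => ⟨hx.1, hx.2.trans_lt hb.2⟩
  refine ⟨fun s hs => ?_, ?_⟩
  · have hb := exp_mem_Ioo hs
    have hk' := hk.mono Ioo_subset_Ico_self
    have := (intervalIntegral.integral_hasDerivAt_right (hint _ hb).intervalIntegrable
      (hk'.stronglyMeasurableAtFilter isOpen_Ioo _ hb)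
      (hk'.continuousAt (Ioo_mem_nhds hb.1 hb.2))).comp s (Real.hasDerivAt_exp s)
    refine this.congr_deriv ?_
    rw [logWeight, two_mul, Real.exp_add]
    ring_nf
  · have hc := intervalIntegral.continuousOn_primitive_interval
      (μ := volume) ((hint (1 / 2) (by norm_num)).integrableOn_compact isCompact_uIcc) 0
      left_mem_uIcc
    have hc' := Tendsto.comp hc (tendsto_nhdsWithin_iff.2 ⟨Real.tendsto_exp_atBot, by
      filter_upwards [Real.tendsto_exp_atBot.eventually_lt_const
        (show (0 : ℝ) < 1 / 2 by norm_num)] with s hs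
      rw [uIcc_of_le (by norm_num)]
      exact ⟨(Real.exp_pos s).le, hs.le⟩⟩)
    simpa using! hc'

theorem continuousOn_norm_rpow_mul_areaWeight {p : ℝ} (hp : 0 < p) (α : ℝ) {f : ℂ → ℂ}
    (hf : ContinuousOn f (Metric.ball (0 : ℂ) 1)) :
    ContinuousOn (fun z => ‖f z‖ ^ p * areaWeight α z) (Metric.ball (0 : ℂ) 1) := by
  refine (hf.norm.rpow_const fun _ _ => Or.inr hp.le).mul
    (ContinuousOn.rpow_const (by fun_prop) fun z hz => Or.inl ?_)
  rw [mem_ball_zero_iff] at hz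
  have := norm_nonneg z
  nlinarith

theorem integrableOn_norm_rpow_mul_areaWeight {p : ℝ} (hp : 0 < p) (α : ℝ) {f : ℂ → ℂ}
    (hf : ContinuousOn f (Metric.ball (0 : ℂ) 1)) {r : ℝ} (hr : r < 1) :
    IntegrableOn (fun z => ‖f z‖ ^ p * areaWeight α z) (Metric.ball (0 : ℂ) r) :=
  (((continuousOn_norm_rpow_mul_areaWeight hp α hf).mono
    (Metric.closedBall_subset_ball hr)).integrableOn_compact (isCompact_closedBall 0 r)).mono_set
    Metric.ball_subset_closedBall

theorem setIntegral_ball_eq_radialIntegral {p : ℝ} (hp : 0 < p) (α : ℝ) {f : ℂ → ℂ}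
    (hf : ContinuousOn f (Metric.ball (0 : ℂ) 1)) {r : ℝ} (hr : r ∈ Ioo (0 : ℝ) 1) :
    ∫ z in Metric.ball (0 : ℂ) r, ‖f z‖ ^ p * areaWeight α z =
      ∫ ρ in (0 : ℝ)..r, circlePowerIntegral p f ρ * (ρ * (1 - ρ ^ 2) ^ α) := by
  set g : ℂ → ℝ := fun z => ‖f z‖ ^ p * areaWeight α z with hg
  have hgc : ContinuousOn g (Metric.ball (0 : ℂ) 1) :=
    continuousOn_norm_rpow_mul_areaWeight hp α hf
  have hpi : -Real.pi ≤ Real.pi := by linarith [Real.pi_pos]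
  have hsymm : ∀ x : ℝ × ℝ, Complex.polarCoord.symm x =
      x.1 * Complex.exp (x.2 * Complex.I) := fun x => by
    rw [Complex.polarCoord_symm_apply, Complex.exp_mul_I, Complex.ofReal_cos, Complex.ofReal_sin]
  set G : ℝ × ℝ → ℝ := fun x => x.1 * g (x.1 * Complex.exp (x.2 * Complex.I)) with hG
  have hGint : IntegrableOn G (Ioo 0 r ×ˢ Ioo (-Real.pi) Real.pi) := by
    have hcomp : IsCompact (Icc 0 r ×ˢ Icc (-Real.pi) Real.pi) := isCompact_Icc.prod isCompact_Icc
    refine IntegrableOn.mono_set (ContinuousOn.integrableOn_compact hcomp ?_)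
      (prod_mono Ioo_subset_Icc_self Ioo_subset_Icc_self)
    refine continuousOn_fst.mul (hgc.comp (by fun_prop) fun x hx => ?_)
    exact mul_exp_mul_I_mem_ball ⟨hx.1.1, hx.1.2.trans_lt hr.2⟩ _
  rw [← integral_indicator Metric.isOpen_ball.measurableSet, ← Complex.integral_comp_polarCoord_symm]
  have htarget : polarCoord.target = Ioi (0 : ℝ) ×ˢ Ioo (-Real.pi) Real.pi := rfl
  have hstep : ∫ x in polarCoord.target,
      x.1 • (Metric.ball (0 : ℂ) r).indicator g (Complex.polarCoord.symm x) =
      ∫ x in polarCoord.target, (Ioo 0 r ×ˢ Ioo (-Real.pi) Real.pi).indicator G x := by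
    refine setIntegral_congr_fun (htarget ▸ (measurableSet_Ioi.prod measurableSet_Ioo))
      fun x hx => ?_
    obtain ⟨h1, h2⟩ : 0 < x.1 ∧ x.2 ∈ Ioo (-Real.pi) Real.pi := hx
    simp only [hsymm, indicator, mem_ball_zero_iff, norm_mul_exp_mul_I h1.le, mem_prod, mem_Ioo, h1,
      true_and, smul_eq_mul, hG]
    by_cases h : x.1 < r
    · rw [if_pos h, if_pos ⟨h, h2⟩]
    · rw [if_neg h, if_neg fun h' => h h'.1, mul_zero]
  rw [hstep, setIntegral_indicator (measurableSet_Ioo.prod measurableSet_Ioo), htarget,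
    inter_eq_self_of_subset_right (prod_mono Ioo_subset_Ioi_self subset_rfl),
    Measure.volume_eq_prod, setIntegral_prod _ (by rwa [← Measure.volume_eq_prod]),
    intervalIntegral.integral_of_le hr.1.le, integral_Ioc_eq_integral_Ioo]
  refine setIntegral_congr_fun measurableSet_Ioo fun ρ hρ => ?_
  simp only [circlePowerIntegral]
  rw [← integral_Ioc_eq_integral_Ioo, ← intervalIntegral.integral_of_le hpi,
    ← intervalIntegral.integral_mul_const]
  refine intervalIntegral.integral_congr fun θ _ => ?_
  simp only [hG, hg, areaWeight, norm_mul_exp_mul_I hρ.1.le]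
  ring

/-! ### Assembly -/

theorem theorem1 (p α : ℝ) (hp : 0 < p) (hα₁ : -2 ≤ α) (hα₂ : α ≤ 0)
    (f : ℂ → ℂ) (hf : AnalyticOnNhd ℂ f (Metric.ball (0 : ℂ) 1)) :
    (∀ r ∈ Ioo (0 : ℝ) 1,
      IntegrableOn (fun z => ‖f z‖ ^ p * areaWeight α z) (Metric.ball (0 : ℂ) r) ∧
      IntegrableOn (areaWeight α) (Metric.ball (0 : ℂ) r) ∧
      0 < ∫ z in Metric.ball (0 : ℂ) r, areaWeight α z) ∧
    ((∃ z ∈ Metric.ball (0 : ℂ) 1, f z ≠ 0) →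
      ∀ r ∈ Ioo (0 : ℝ) 1, 0 < areaIntegralMean p α f r) ∧
    LogConvexInLog (areaIntegralMean p α f) := by
  set Φ : ℝ → ℝ := fun s => ∫ ρ in (0 : ℝ)..Real.exp s, 1 * (ρ * (1 - ρ ^ 2) ^ α) with hΦdef
  have hΦ : IsPrimitiveFromBot Φ (logWeight α) := by
    have h := isPrimitiveFromBot_radialIntegral α (h := fun _ => 1) continuousOn_const
    simp only [one_mul (logWeight _ _)] at h
    exact h
  have hΦpos : ∀ s < 0, 0 < Φ s := fun s hs => hΦ.pos (fun t ht => logWeight_pos α ht) hs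
  have hpi := Real.pi_pos
  have hone : (fun z : ℂ => ‖(1 : ℂ)‖ ^ p * areaWeight α z) = areaWeight α := by
    funext z
    rw [norm_one, Real.one_rpow, one_mul]
  have hden : ∀ s < 0, ∫ z in Metric.ball (0 : ℂ) (Real.exp s), areaWeight α z =
      2 * Real.pi * Φ s := fun s hs => by
    have h := setIntegral_ball_eq_radialIntegral hp α (f := fun _ => 1) continuousOn_const
      (exp_mem_Ioo hs)
    rw [hone] at h
    have hc : ∀ ρ : ℝ, circlePowerIntegral p (fun _ => 1) ρ = 2 * Real.pi := fun ρ => by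
      simp only [circlePowerIntegral, norm_one, Real.one_rpow, intervalIntegral.integral_const,
        smul_eq_mul, mul_one]
      ring
    rw [h, hΦdef, ← intervalIntegral.integral_const_mul]
    refine intervalIntegral.integral_congr fun ρ _ => ?_
    simp only [hc, one_mul]
  have hden_pos : ∀ r ∈ Ioo (0 : ℝ) 1, 0 < ∫ z in Metric.ball (0 : ℂ) r, areaWeight α z :=
    fun r hr => by
    have hs : Real.log r < 0 := Real.log_neg hr.1 hr.2
    have h := hden _ hs
    rw [Real.exp_log hr.1] at h
    rw [h]
    have := hΦpos _ hs
    positivity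
  set F : ℝ → ℝ := fun s => ∫ ρ in (0 : ℝ)..Real.exp s,
    circlePowerIntegral p f ρ * (ρ * (1 - ρ ^ 2) ^ α) with hFdef
  have hF : IsPrimitiveFromBot F
      (fun s => circlePowerIntegral p f (Real.exp s) * logWeight α s) :=
    isPrimitiveFromBot_radialIntegral α (continuousOn_circlePowerIntegral hp hf.continuousOn)
  have hmean : ∀ s < 0, areaIntegralMean p α f (Real.exp s) = F s / (2 * Real.pi * Φ s) :=
    fun s hs => by
    rw [areaIntegralMean, hden s hs,
      setIntegral_ball_eq_radialIntegral hp α hf.continuousOn (exp_mem_Ioo hs)]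
  have hFpos : (∃ z ∈ Metric.ball (0 : ℂ) 1, f z ≠ 0) → ∀ s < 0, 0 < F s := fun hne s hs =>
    hF.pos (fun t ht => mul_pos (circlePowerIntegral_pos hp hf hne (exp_mem_Ioo ht))
      (logWeight_pos α ht)) hs
  refine ⟨fun r hr => ⟨integrableOn_norm_rpow_mul_areaWeight hp α hf.continuousOn hr.2, ?_,
    hden_pos r hr⟩, fun hne r hr => ?_, ?_⟩
  · rw [← hone]
    exact integrableOn_norm_rpow_mul_areaWeight hp α (f := fun _ => 1) continuousOn_const hr.2
  · have hs : Real.log r < 0 := Real.log_neg hr.1 hr.2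
    rw [← Real.exp_log hr.1, hmean _ hs]
    have h1 := hΦpos _ hs
    have h2 := hFpos hne _ hs
    positivity
  · by_cases hne : ∃ z ∈ Metric.ball (0 : ℂ) 1, f z ≠ 0
    · have hpow : ∀ c, 0 ≤ c →
          ∃ P : ℝ → ℝ, IsPrimitiveFromBot P (fun s => Real.exp (c * s) * logWeight α s) := by
        intro c hc
        have h := isPrimitiveFromBot_radialIntegral α (h := fun ρ : ℝ => ρ ^ c)
          (continuousOn_id.rpow_const fun _ _ => Or.inr hc)
        simp only [← Real.exp_mul] at h
        exact ⟨_, by simpa only [mul_comm c] using h⟩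
      have hconv := convexOn_log_primitive_div hα₁ hα₂
        (fun s hs => circlePowerIntegral_pos hp hf hne (exp_mem_Ioo hs))
        (monotoneOn_circlePowerIntegral_exp hp hf hne)
        (convexOn_log_circlePowerIntegral hp hf hne) hΦ hF hpow
      -- The factor 2π in the denominator only shifts the logarithm by a constant.
      refine (hconv.add_const (-Real.log (2 * Real.pi))).congr fun s hs => ?_
      have h1 := hΦpos s hs
      have h2 := hFpos hne s hs
      simp only [hmean s hs, Pi.add_apply]
      rw [← Real.log_inv, ← Real.log_mul (by positivity) (by positivity)]
      congr 1
      field_simp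
    · push Not at hne
      -- For f vanishing on the disk the mean is 0, and `Real.log 0 = 0` makes the function
      -- constant.
      refine (convexOn_const (0 : ℝ) (convex_Iio 0)).congr fun s hs => ?_
      have h0 : ∫ z in Metric.ball (0 : ℂ) (Real.exp s), ‖f z‖ ^ p * areaWeight α z = 0 := by
        refine setIntegral_eq_zero_of_forall_eq_zero fun z hz => ?_
        rw [hne z (Metric.ball_subset_ball (exp_mem_Ioo hs).2.le hz), norm_zero,
          Real.zero_rpow hp.ne', zero_mul]
      simp only [areaIntegralMean, h0, zero_div, Real.log_zero]
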